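/- For a real $n\times n$ matrix $A$, a real number $\lambda$ is a complementarity eigenvalue of $A$ if there is a nonzero vector $x\ge 0$ with $Ax\ge\lambda x$ and $\langle x, Ax-\lambda x\rangle=0$. The complementarity spectrum $\Pi(D)$ of a finite digraph $D$ is the set of complementarity eigenvalues of its adjacency matrix $A(D)$, where $A(D)_{uv}=1$ if $(u,v)$ is an arc and $A(D)_{uv}=0$ otherwise; $\rho(D)$ denotes the spectral radius of $D$, that is, the largest modulus of a complex eigenvalue of $A(D)$. Let $n\ge 4$ and, for $j\in\{2,\dots,n-1\}$, let $D(j)$ be the digraph obtained from the directed cycle $1\to 2\to\cdots\to n\to 1$ by adding the arcs $(2,1)$ and $(j+1,j)$. **Theorem.** Every $D(j)$ with $2\le j\le n-1$ has order (number of vertices) $n$ and size (number of arcs) $n+2$. All $D(j)$ with $3\le j\le n-1$, that is, those in which the two directed $2$-cycles created by the added arcs are disjoint, have the same complementarity spectrum; it is $$\Pi(D(j))=\{0,1,\rho(D(j))\},$$ and $\rho(D(j))$ is the largest real root of $x^n-2x^{n-2}+x^{n-4}-1$. -/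

import Mathlib

noncomputable section

/-- `lam` is a complementarity eigenvalue of the real matrix `A`: some nonzero nonnegative vector
`x` satisfies `A x ≥ lam x` and `⟨x, A x - lam x⟩ = 0`. -/
def Matrix.IsComplementarityEigenvalue {V : Type*} [Fintype V] (A : Matrix V V ℝ) (lam : ℝ) :
    Prop :=
  ∃ x : V → ℝ, x ≠ 0 ∧ 0 ≤ x ∧ lam • x ≤ A.mulVec x ∧
    dotProduct x (A.mulVec x - lam • x) = 0

/-- The complementarity spectrum of a real matrix. -/
def Matrix.complementaritySpectrum {V : Type*} [Fintype V] (A : Matrix V V ℝ) : Set ℝ :=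
  {lam | A.IsComplementarityEigenvalue lam}

/-- The number of vertices. -/
def Digraph.order {V : Type*} (_D : Digraph V) : ℕ := Nat.card V

/-- The number of arcs. -/
def Digraph.size {V : Type*} (D : Digraph V) : ℕ := Set.ncard {e : V × V | D.Adj e.1 e.2}

open Classical in
/-- The adjacency matrix, with entry `1` at `(u, v)` when `(u, v)` is an arc and `0` otherwise. -/
def Digraph.adjMatrix {V : Type*} (D : Digraph V) (R : Type*) [Zero R] [One R] : Matrix V V R :=
  Matrix.of fun u v => if D.Adj u v then 1 else 0

/-- The complementarity spectrum of a finite digraph. -/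
def Digraph.complementaritySpectrum {V : Type*} [Fintype V] (D : Digraph V) : Set ℝ :=
  (D.adjMatrix ℝ).complementaritySpectrum

/-- The spectral radius of a finite digraph: the largest modulus of a complex eigenvalue of its
adjacency matrix. -/
def Digraph.rho {V : Type*} [Fintype V] [DecidableEq V] (D : Digraph V) : ℝ :=
  (spectralRadius ℂ (D.adjMatrix ℂ)).toReal

/-- The label in `{1, …, n}` of a vertex. -/
def vertexLabel {n : ℕ} (v : Fin n) : ℕ := (v : ℕ) + 1

/-- The directed cycle `1 → 2 → ⋯ → n → 1`. -/
def directedCycle (n : ℕ) : Digraph (Fin n) where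
  Adj u v := vertexLabel v = vertexLabel u + 1 ∨ (vertexLabel u = n ∧ vertexLabel v = 1)

/-- The digraph on the vertices `1, …, n` whose only arc is `(a, b)`. -/
def singleArc (n a b : ℕ) : Digraph (Fin n) where
  Adj u v := vertexLabel u = a ∧ vertexLabel v = b

/-- The digraph `D(j)`: the directed cycle on `n` vertices with the arcs `(2, 1)` and `(j + 1, j)`
added. -/
def cycleWithTwoBackArcs (n j : ℕ) : Digraph (Fin n) :=
  directedCycle n ⊔ singleArc n 2 1 ⊔ singleArc n (j + 1) j

end

/-! On the support of a complementarity eigenvector, `A x = a x` holds exactly. For `a ≠ 0, 1` the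
support is closed along the cycle: if `x` vanished at the cycle successor of a support vertex, only
a back arc could supply the value there, and the two vertices of that 2-cycle would force `a ^ 2 =
1`. So `x` is a positive eigenvector.

Solving `A x = a x` around the cycle, each 2-cycle contributes a factor `a ^ 2 - 1` in place of `a ^
2`, wherever it sits, as long as the two are disjoint. Closing up gives `a ^ (n - 4) * (a ^ 2 - 1) ^
2 = 1`, the stated polynomial in factored form, free of `j`. It has exactly one root above `1`; that
root has a positive eigenvector, so it is the spectral radius. The values `0` and `1` come from a
single vertex and from a 2-cycle. -/

open Matrix in
theorem cycleWithTwoBackArcs_mulVec {R : Type*} [Semiring R] {n j : ℕ} (hn : 4 ≤ n) (hj : 2 ≤ j)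
    (hjn : j < n) (x : Fin n → R) (u : Fin n) :
    (((cycleWithTwoBackArcs n j).adjMatrix R) *ᵥ x) u =
      x ⟨(u + 1) % n, Nat.mod_lt _ (by omega)⟩ + (if (u : ℕ) = 1 then x ⟨0, by omega⟩ else 0) +
        (if (u : ℕ) = j then x ⟨j - 1, by omega⟩ else 0) := by
  classical
  have key : ∀ v : Fin n, (cycleWithTwoBackArcs n j).adjMatrix R u v =
      (if v = ⟨(u + 1) % n, Nat.mod_lt _ (by omega)⟩ then 1 else 0) +
        (if (u : ℕ) = 1 then (if v = ⟨0, by omega⟩ then 1 else 0) else 0) +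
        (if (u : ℕ) = j then (if v = ⟨j - 1, by omega⟩ then 1 else 0) else 0) := by
    intro v
    have hu := u.2
    have hv := v.2
    have hmod : (u.1 + 1 < n ∧ (u.1 + 1) % n = u.1 + 1) ∨ (u.1 + 1 = n ∧ (u.1 + 1) % n = 0) := by
      rcases Nat.lt_or_ge (u.1 + 1) n with h | h
      · exact Or.inl ⟨h, Nat.mod_eq_of_lt h⟩
      · have : u.1 + 1 = n := by omega
        exact Or.inr ⟨this, by rw [this, Nat.mod_self]⟩
    have hadj : (cycleWithTwoBackArcs n j).Adj u v ↔
        ((v : ℕ) = (u + 1) % n ∨ ((u : ℕ) = 1 ∧ (v : ℕ) = 0)) ∨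
          ((u : ℕ) = j ∧ (v : ℕ) = j - 1) := by
      simp only [cycleWithTwoBackArcs, directedCycle, singleArc, Digraph.sup_adj, vertexLabel]
      omega
    simp only [Digraph.adjMatrix, Matrix.of_apply, hadj, Fin.ext_iff]
    split_ifs <;> first | (exfalso; omega) | simp
  simp only [Matrix.mulVec, dotProduct, key, add_mul, Finset.sum_add_distrib]
  congr 1
  · congr 1
    · simp
    · split_ifs <;> simp
  · split_ifs <;> simp

/-- Applying the adjacency matrix to the all-ones vector gives the out-degrees, whose sum counts the
arcs. -/
theorem cycleWithTwoBackArcs_size {n j : ℕ} (hn : 4 ≤ n) (hj : 2 ≤ j) (hjn : j < n) :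
    (cycleWithTwoBackArcs n j).size = n + 2 := by
  classical
  have h1 : (cycleWithTwoBackArcs n j).size =
      ∑ u, ((cycleWithTwoBackArcs n j).adjMatrix ℕ).mulVec (fun _ => 1) u := by
    unfold Digraph.size
    rw [Set.ncard_eq_toFinset_card', Set.toFinset_ofPred, Finset.card_filter,
      Fintype.sum_prod_type]
    simp [Matrix.mulVec, dotProduct, Digraph.adjMatrix]
  have h2 : ∀ k < n, (∑ u : Fin n, if (u : ℕ) = k then 1 else 0) = 1 := by
    intro k hk
    have : ∀ u : Fin n, (u : ℕ) = k ↔ u = ⟨k, hk⟩ := fun u => by simp [Fin.ext_iff]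
    simp [this]
  rw [h1]
  simp only [cycleWithTwoBackArcs_mulVec hn hj hjn, Finset.sum_add_distrib]
  rw [h2 1 (by omega), h2 j hjn]
  simp

/-! ### The characteristic equation and its root above `1` -/

theorem exists_root_gt_one (m : ℕ) : ∃ r : ℝ, 1 < r ∧ r ^ m * (r ^ 2 - 1) ^ 2 = 1 := by
  have hc : ContinuousOn (fun r : ℝ => r ^ m * (r ^ 2 - 1) ^ 2) (Set.Icc 1 2) := by fun_prop
  have h2 : (1 : ℝ) ≤ 2 ^ m := one_le_pow₀ (by norm_num)
  obtain ⟨r, hr, h⟩ := intermediate_value_Icc (by norm_num) hc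
    (show (1 : ℝ) ∈ Set.Icc _ _ by constructor <;> norm_num; nlinarith)
  refine ⟨r, lt_of_le_of_ne hr.1 ?_, h⟩
  rintro rfl
  norm_num at h

theorem root_gt_one_unique {m : ℕ} {r s : ℝ} (hr : 1 < r) (hs : 1 < s)
    (hr1 : r ^ m * (r ^ 2 - 1) ^ 2 = 1) (hs1 : s ^ m * (s ^ 2 - 1) ^ 2 = 1) : r = s := by
  have key : ∀ a b : ℝ, 1 < a → a < b →
      a ^ m * (a ^ 2 - 1) ^ 2 < b ^ m * (b ^ 2 - 1) ^ 2 := by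
    intro a b ha hab
    have h1 : a ^ 2 - 1 < b ^ 2 - 1 := by nlinarith
    have h2 : 0 < a ^ 2 - 1 := by nlinarith
    have h3 : a ^ m ≤ b ^ m := by gcongr
    have h4 : (a ^ 2 - 1) ^ 2 < (b ^ 2 - 1) ^ 2 := by gcongr
    exact mul_lt_mul' h3 h4 (by positivity) (pow_pos (by linarith) m)
  rcases lt_trichotomy r s with h | h | h
  · linarith [key r s hr h]
  · exact h
  · linarith [key s r hs h]

theorem isGreatest_root {n : ℕ} (hn : 4 ≤ n) {r : ℝ} (hr : 1 < r)
    (hr1 : r ^ (n - 4) * (r ^ 2 - 1) ^ 2 = 1) :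
    IsGreatest {x : ℝ | (Polynomial.X ^ n - 2 * Polynomial.X ^ (n - 2) +
      Polynomial.X ^ (n - 4) - 1 : Polynomial ℝ).IsRoot x} r := by
  have key : ∀ x : ℝ, (Polynomial.X ^ n - 2 * Polynomial.X ^ (n - 2) +
      Polynomial.X ^ (n - 4) - 1 : Polynomial ℝ).IsRoot x ↔
      x ^ (n - 4) * (x ^ 2 - 1) ^ 2 = 1 := by
    intro x
    obtain ⟨m, rfl⟩ := Nat.exists_eq_add_of_le' hn
    simp only [Polynomial.IsRoot.def, Polynomial.eval_sub, Polynomial.eval_add,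
      Polynomial.eval_mul, Polynomial.eval_pow, Polynomial.eval_X, Polynomial.eval_one,
      Polynomial.eval_ofNat, show m + 4 - 2 = m + 2 by omega, Nat.add_sub_cancel]
    constructor <;> intro h <;> linear_combination h
  constructor
  · exact (key r).2 hr1
  · intro x hx
    rcases le_or_gt x 1 with h | h
    · linarith
    · exact (root_gt_one_unique h hr ((key x).1 hx) hr1).le

/-! ### Positive eigenvector and spectral radius -/

theorem exists_pos_eigenvector {n j : ℕ} (hn : 4 ≤ n) (hj : 3 ≤ j) (hjn : j < n) {r : ℝ}
    (hr : 1 < r) (hr1 : r ^ (n - 4) * (r ^ 2 - 1) ^ 2 = 1) :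
    ∃ x : Fin n → ℝ, (∀ u, 0 < x u) ∧
      ((cycleWithTwoBackArcs n j).adjMatrix ℝ).mulVec x = r • x := by
  have h2 : 0 < r ^ 2 - 1 := by nlinarith
  obtain ⟨i, rfl⟩ := Nat.exists_eq_add_of_le' hj
  -- The solution of the eigenvector recursion started at `w 0 = 1`; a factor `r ^ 2 - 1` replaces
  -- `r ^ 2` after each back arc. The equation for `r` is exactly the closing condition `w n = w 0`.
  let w : ℕ → ℝ := fun k => if k = 0 then 1 else if k = 1 then r else
    if k ≤ i + 3 then r ^ (k - 2) * (r ^ 2 - 1) else r ^ (k - 4) * (r ^ 2 - 1) ^ 2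
  have w0 : w 0 = 1 := by simp [w]
  have w1 : w 1 = r := by simp [w]
  have wa : ∀ k, k + 2 ≤ i + 3 → w (k + 2) = r ^ k * (r ^ 2 - 1) := fun k hk => by
    simp [w, hk]
  have wb : ∀ k, i + 3 < k + 4 → w (k + 4) = r ^ k * (r ^ 2 - 1) ^ 2 := fun k hk => by
    simp only [w]; rw [if_neg (by omega), if_neg (by omega), if_neg (by omega)]; simp
  have wn : w n = 1 := by
    obtain ⟨m, rfl⟩ := Nat.exists_eq_add_of_le' hn
    rw [wb m (by omega)]
    simpa using hr1
  refine ⟨fun u => w u, fun u => ?_, funext fun u => ?_⟩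
  · simp only [w]
    split_ifs <;> positivity
  rw [cycleWithTwoBackArcs_mulVec hn (by omega) hjn]
  have hmod : w ((u.1 + 1) % n) = w (u.1 + 1) := by
    rcases Nat.lt_or_ge (u.1 + 1) n with h | h
    · rw [Nat.mod_eq_of_lt h]
    · have : u.1 + 1 = n := by omega
      rw [this, Nat.mod_self, wn, w0]
  simp only [hmod, Pi.smul_apply, smul_eq_mul]
  generalize u.1 = k
  rcases Nat.lt_or_ge k 2 with hk | hk
  · interval_cases k
    · simp [w0, w1]
    · rw [wa 0 (by omega), w0, w1]
      simp
      ring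
  · obtain ⟨k, rfl⟩ := Nat.exists_eq_add_of_le' hk
    rw [if_neg (by omega)]
    rcases lt_trichotomy (k + 2) (i + 3) with h | h | h
    · rw [if_neg (by omega), wa k (by omega), wa (k + 1) (by omega)]
      ring
    · obtain rfl : k = i + 1 := by omega
      rw [if_pos rfl, show i + 3 - 1 = i + 2 by omega, wb i (by omega), wa i (by omega),
        wa (i + 1) (by omega)]
      ring
    · obtain ⟨k, rfl⟩ : ∃ l, k = l + 2 := ⟨k - 2, by omega⟩
      rw [if_neg (by omega), wb k (by omega), show k + 2 + 2 + 1 = k + 1 + 4 by omega,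
        wb (k + 1) (by omega)]
      ring

/-- A nonnegative matrix with a positive eigenvector has the corresponding eigenvalue as its
spectral radius. -/
theorem spectralRadius_eq_of_pos_eigenvector {V : Type*} [Fintype V] [DecidableEq V] [Nonempty V]
    {A : Matrix V V ℝ} (hA : ∀ u v, 0 ≤ A u v) {r : ℝ} (hr : 0 ≤ r) {x : V → ℝ}
    (hx : ∀ u, 0 < x u) (hAx : A.mulVec x = r • x) :
    (spectralRadius ℂ (A.map ((↑) : ℝ → ℂ))).toReal = r := by
  have hspec : ∀ z : ℂ, z ∈ spectrum ℂ (A.map ((↑) : ℝ → ℂ)) ↔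
      ∃ y : V → ℂ, y ≠ 0 ∧ (A.map ((↑) : ℝ → ℂ)).mulVec y = z • y := by
    intro z
    rw [← Matrix.spectrum_toLin', ← Module.End.hasEigenvalue_iff_mem_spectrum]
    constructor
    · intro h
      obtain ⟨y, hy⟩ := h.exists_hasEigenvector
      exact ⟨y, hy.2, by simpa using hy.apply_eq_smul⟩
    · rintro ⟨y, h0, hy⟩
      exact Module.End.hasEigenvalue_of_hasEigenvector
        ⟨Module.End.mem_eigenspace_iff.2 (by simpa using hy), h0⟩
  have hmem : (r : ℂ) ∈ spectrum ℂ (A.map ((↑) : ℝ → ℂ)) := by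
    refine (hspec _).2 ⟨fun u => x u, ?_, funext fun u => ?_⟩
    · intro h
      obtain ⟨u⟩ := ‹Nonempty V›
      have := congrFun h u
      simp only [Pi.zero_apply, Complex.ofReal_eq_zero] at this
      exact (hx u).ne' this
    · have := congrFun hAx u
      simp only [Matrix.mulVec, dotProduct, Pi.smul_apply, smul_eq_mul, Matrix.map_apply] at this ⊢
      exact_mod_cast this
  have hle : ∀ z ∈ spectrum ℂ (A.map ((↑) : ℝ → ℂ)), ‖z‖ ≤ r := by
    intro z hz
    obtain ⟨y, h0, hy⟩ := (hspec z).1 hz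
    -- At a vertex maximizing `‖y u‖ / x u`, the triangle inequality in row `u` compares `y` with
    -- the multiple of `x` that dominates it.
    obtain ⟨u, hu⟩ := Finite.exists_max fun u => ‖y u‖ / x u
    have hbound : ∀ v, ‖y v‖ ≤ ‖y u‖ / x u * x v := fun v => (div_le_iff₀ (hx v)).1 (hu v)
    have hyu : 0 < ‖y u‖ := by
      refine lt_of_le_of_ne (norm_nonneg _) fun h => h0 (funext fun v => ?_)
      have := hbound v
      rw [← h, zero_div, zero_mul] at this
      exact norm_le_zero_iff.1 this
    refine le_of_mul_le_mul_right ?_ hyu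
    have e1 := congrFun hy u
    have e2 := congrFun hAx u
    simp only [Matrix.mulVec, dotProduct, Pi.smul_apply, smul_eq_mul, Matrix.map_apply] at e1 e2
    calc ‖z‖ * ‖y u‖ = ‖∑ v, (A u v : ℂ) * y v‖ := by rw [e1, norm_mul]
      _ ≤ ∑ v, ‖(A u v : ℂ) * y v‖ := norm_sum_le _ _
      _ ≤ ∑ v, ‖y u‖ / x u * (A u v * x v) := by
        refine Finset.sum_le_sum fun v _ => ?_
        rw [norm_mul, Complex.norm_real, Real.norm_of_nonneg (hA u v)]
        calc A u v * ‖y v‖ ≤ A u v * (‖y u‖ / x u * x v) :=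
              mul_le_mul_of_nonneg_left (hbound v) (hA u v)
          _ = _ := by ring
      _ = r * ‖y u‖ := by
        rw [← Finset.mul_sum, e2]
        have := (hx u).ne'
        field_simp
  have : spectralRadius ℂ (A.map ((↑) : ℝ → ℂ)) = ENNReal.ofReal r := by
    apply le_antisymm
    · refine iSup₂_le fun z hz => ?_
      rw [← enorm_eq_nnnorm, ← ofReal_norm]
      exact ENNReal.ofReal_le_ofReal (hle z hz)
    · refine le_trans ?_ (le_iSup₂ (f := fun (z : ℂ) (_ : z ∈ spectrum ℂ _) => (‖z‖₊ : ENNReal))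
        (r : ℂ) hmem)
      rw [← enorm_eq_nnnorm, ← ofReal_norm, Complex.norm_real, Real.norm_of_nonneg hr]
  rw [this, ENNReal.toReal_ofReal hr]

theorem Digraph.adjMatrix_nonneg {V : Type*} (D : Digraph V) (u v : V) :
    0 ≤ D.adjMatrix ℝ u v := by
  simp only [Digraph.adjMatrix, Matrix.of_apply]
  split_ifs <;> simp

theorem cycleWithTwoBackArcs_rho {n j : ℕ} (hn : 4 ≤ n) (hj : 3 ≤ j) (hjn : j < n) {r : ℝ}
    (hr : 1 < r) (hr1 : r ^ (n - 4) * (r ^ 2 - 1) ^ 2 = 1) :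
    (cycleWithTwoBackArcs n j).rho = r := by
  obtain ⟨x, hx, hAx⟩ := exists_pos_eigenvector hn hj hjn hr hr1
  have : Nonempty (Fin n) := ⟨⟨0, by omega⟩⟩
  rw [← spectralRadius_eq_of_pos_eigenvector (Digraph.adjMatrix_nonneg _) (by linarith) hx hAx]
  unfold Digraph.rho
  congr 2
  ext u v
  simp only [Digraph.adjMatrix, Matrix.of_apply, Matrix.map_apply]
  split_ifs <;> simp

/-! ### The complementarity eigenvalues -/

theorem Matrix.IsComplementarityEigenvalue.of_mulVec_eq {V : Type*} [Fintype V] [Nonempty V]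
    {A : Matrix V V ℝ} {r : ℝ} {x : V → ℝ} (hx : ∀ u, 0 < x u) (hAx : A.mulVec x = r • x) :
    A.IsComplementarityEigenvalue r := by
  obtain ⟨u⟩ := ‹Nonempty V›
  exact ⟨x, fun h => (hx u).ne' (congrFun h u), fun u => (hx u).le, hAx.ge, by simp [hAx]⟩

/-- Witness: the indicator of the first vertex, which carries no loop. -/
theorem isComplementarityEigenvalue_zero {n j : ℕ} (hn : 4 ≤ n) (hj : 3 ≤ j) (hjn : j < n) :
    ((cycleWithTwoBackArcs n j).adjMatrix ℝ).IsComplementarityEigenvalue 0 := by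
  refine ⟨Pi.single ⟨0, by omega⟩ 1, by simp, by simp, fun u => ?_, ?_⟩
  · rw [cycleWithTwoBackArcs_mulVec hn (by omega) hjn]
    have : (0 : Fin n → ℝ) ≤ Pi.single (⟨0, by omega⟩ : Fin n) (1 : ℝ) := by simp
    have h := fun v => this v
    simp only [Pi.zero_apply, zero_smul] at h ⊢
    have := h ⟨0, by omega⟩
    have := h ⟨j - 1, by omega⟩
    have := h ⟨(u + 1) % n, Nat.mod_lt _ (by omega)⟩
    split_ifs <;> linarith
  · rw [single_dotProduct, Pi.sub_apply, cycleWithTwoBackArcs_mulVec hn (by omega) hjn]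
    have : ¬ 0 = j := by omega
    simp [this, Nat.mod_eq_of_lt (show 1 < n by omega)]

/-- Witness: the indicator of the 2-cycle on the first two vertices; `3 ≤ j` keeps the other back
arc from starting there. -/
theorem isComplementarityEigenvalue_one {n j : ℕ} (hn : 4 ≤ n) (hj : 3 ≤ j) (hjn : j < n) :
    ((cycleWithTwoBackArcs n j).adjMatrix ℝ).IsComplementarityEigenvalue 1 := by
  let x : Fin n → ℝ := fun u => if (u : ℕ) ≤ 1 then 1 else 0
  have hx : ∀ u, 0 ≤ x u := fun u => by simp only [x]; split_ifs <;> simp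
  have h0 : x ⟨0, by omega⟩ = 1 := by simp [x]
  have heq : ∀ u : Fin n, (u : ℕ) ≤ 1 →
      ((cycleWithTwoBackArcs n j).adjMatrix ℝ).mulVec x u = 1 := by
    intro u hu
    rw [cycleWithTwoBackArcs_mulVec hn (by omega) hjn, if_neg (by omega : ¬ (u : ℕ) = j)]
    simp only [x, Nat.mod_eq_of_lt (show u.1 + 1 < n by omega)]
    split_ifs <;> first | omega | norm_num
  refine ⟨x, fun h => by simpa [h0] using congrFun h ⟨0, by omega⟩, hx, fun u => ?_, ?_⟩
  · by_cases hu : (u : ℕ) ≤ 1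
    · rw [heq u hu]
      simp [x, hu]
    · have : (1 • x) u = (0 : ℝ) := by simp [x, hu]
      simp only [one_smul] at this ⊢
      rw [this]
      simp only [Matrix.mulVec, dotProduct]
      exact Finset.sum_nonneg fun v _ => mul_nonneg (Digraph.adjMatrix_nonneg _ _ _) (hx v)
  · refine Finset.sum_eq_zero fun u _ => ?_
    by_cases hu : (u : ℕ) ≤ 1
    · simp [heq u hu, x, hu]
    · simp [x, hu]

/-- If a complementarity eigenvalue of `D(j)` is neither `0` nor `1`, the support of its vector is
closed under successors, hence everything, and the eigenvalue is a root greater than `1`. -/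
theorem root_of_isComplementarityEigenvalue {n j : ℕ} (hn : 4 ≤ n) (hj : 3 ≤ j) (hjn : j < n)
    {a : ℝ} (h : ((cycleWithTwoBackArcs n j).adjMatrix ℝ).IsComplementarityEigenvalue a)
    (ha0 : a ≠ 0) (ha1 : a ≠ 1) : 1 < a ∧ a ^ (n - 4) * (a ^ 2 - 1) ^ 2 = 1 := by
  obtain ⟨x, hx0, hx, hle, hdot⟩ := h
  -- The `n`-periodic extension of `x`, so that successors need no reduction mod `n`.
  let y : ℕ → ℝ := fun k => x ⟨k % n, Nat.mod_lt _ (by omega)⟩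
  have hy : ∀ k, 0 ≤ y k := fun k => hx _
  have ymod : ∀ k, y (k % n) = y k := fun k => by simp [y]
  have yfin : ∀ u : Fin n, x u = y u := fun u => by simp [y, Nat.mod_eq_of_lt u.2]
  have hmul : ∀ u : Fin n, ((cycleWithTwoBackArcs n j).adjMatrix ℝ).mulVec x u =
      y (u + 1) + (if (u : ℕ) = 1 then y 0 else 0) + (if (u : ℕ) = j then y (j - 1) else 0) := by
    intro u
    rw [cycleWithTwoBackArcs_mulVec hn (by omega) hjn]
    simp only [yfin, ymod]
  have hcompl : ∀ k < n, 0 < y k →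
      y (k + 1) + (if k = 1 then y 0 else 0) + (if k = j then y (j - 1) else 0) = a * y k := by
    intro k hk hpos
    -- The inner product is a sum of nonnegative terms, so each one vanishes.
    have h1 := (Finset.sum_eq_zero_iff_of_nonneg fun u _ =>
      mul_nonneg (hx u) (sub_nonneg.2 (hle u))).1 hdot ⟨k, hk⟩ (Finset.mem_univ _)
    rw [hmul, yfin, Pi.smul_apply, yfin, smul_eq_mul] at h1
    exact sub_eq_zero.1 ((mul_eq_zero.1 h1).resolve_left hpos.ne')
  obtain ⟨u, hu⟩ := Function.ne_iff.1 hx0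
  have hu : 0 < y u := lt_of_le_of_ne (hy _) fun h => hu (by rw [yfin, ← h]; rfl)
  have ha : 0 < a := by
    refine lt_of_le_of_ne ?_ ha0.symm
    have := hcompl u u.2 hu
    refine nonneg_of_mul_nonneg_left ?_ hu
    rw [← this]
    have := hy (u + 1)
    have := hy 0
    have := hy (j - 1)
    split_ifs <;> linarith
  have hback : ∀ s t : ℝ, 0 < s → t = a * s → s = a * t → False := by
    intro s t hs h1 h2
    have : (a - 1) * ((a + 1) * s) = 0 := by rw [h1] at h2; linear_combination -h2
    rcases mul_eq_zero.1 this with h | h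
    · exact ha1 (by linarith)
    · have : 0 < (a + 1) * s := by positivity
      linarith
  have hsucc : ∀ k < n, 0 < y k → 0 < y (k + 1) := by
    intro k hk hpos
    refine lt_of_le_of_ne (hy _) fun h0 => ?_
    have e := hcompl k hk hpos
    have hak : 0 < a * y k := by positivity
    rw [← h0] at e
    by_cases h1 : k = 1
    · subst h1
      rw [if_pos rfl, if_neg (by omega)] at e
      have e' := hcompl 0 (by omega) (by linarith)
      rw [if_neg (by omega), if_neg (by omega), zero_add] at e'
      exact hback _ _ hpos (by linarith) (by linarith)
    · by_cases h2 : k = j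
      · subst h2
        rw [if_neg h1, if_pos rfl] at e
        have e' := hcompl (k - 1) (by omega) (by linarith)
        rw [if_neg (by omega), if_neg (by omega), Nat.sub_add_cancel (by omega)] at e'
        exact hback _ _ hpos (by linarith) (by linarith)
      · rw [if_neg h1, if_neg h2] at e
        linarith
  have hall : ∀ k, 0 < y (u + k) := by
    intro k
    induction k with
    | zero => exact hu
    | succ k ih =>
      rw [← ymod] at ih
      have := hsucc _ (Nat.mod_lt _ (by omega)) ih
      rwa [← ymod, Nat.mod_add_mod, ymod] at this
  have hpos : ∀ k < n, 0 < y k := by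
    intro k hk
    -- Adding `n` keeps the natural subtraction from truncating.
    have := hall (k + n - u)
    rwa [show u.1 + (k + n - u) = k + n by omega, ← ymod, Nat.add_mod_right, ymod] at this
  have hrec := fun k hk => hcompl k hk (hpos k hk)
  have y1 : y 1 = a * y 0 := by
    have := hrec 0 (by omega)
    rw [if_neg (by omega), if_neg (by omega)] at this
    simpa using this
  have y2 : y 2 = (a ^ 2 - 1) * y 0 := by
    have := hrec 1 (by omega)
    rw [if_pos rfl, if_neg (by omega), y1] at this
    norm_num at this
    linear_combination this
  have ya : ∀ k, k + 2 ≤ j → y (k + 2) = a ^ k * (a ^ 2 - 1) * y 0 := by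
    intro k
    induction k with
    | zero => intro _; simpa using y2
    | succ k ih =>
      intro hk
      have := hrec (k + 2) (by omega)
      rw [if_neg (by omega), if_neg (by omega), ih (by omega)] at this
      rw [show k + 1 + 2 = k + 2 + 1 by omega]
      linear_combination this
  obtain ⟨i, rfl⟩ := Nat.exists_eq_add_of_le' hj
  have yb : ∀ k, i ≤ k → k + 4 ≤ n → y (k + 4) = a ^ k * (a ^ 2 - 1) ^ 2 * y 0 := by
    intro k hk
    induction k, hk using Nat.le_induction with
    | base =>
      intro _
      have := hrec (i + 3) (by omega)
      rw [if_neg (by omega), if_pos rfl, show i + 3 - 1 = i + 2 by omega, ya i (by omega),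
        show i + 3 = i + 1 + 2 by omega, ya (i + 1) (by omega)] at this
      rw [show i + 4 = i + 1 + 2 + 1 by omega]
      linear_combination this
    | succ k hk ih =>
      intro hk'
      have := hrec (k + 4) (by omega)
      rw [if_neg (by omega), if_neg (by omega), ih (by omega)] at this
      rw [show k + 1 + 4 = k + 4 + 1 by omega]
      linear_combination this
  have p0 := hpos 0 (by omega)
  have p2 := hpos 2 (by omega)
  constructor
  -- Positivity of `y 2 = (a ^ 2 - 1) * y 0` is what excludes roots in `(0, 1)`.
  · rw [y2] at p2
    have := pos_of_mul_pos_left p2 p0.le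
    nlinarith
  · have h1 := yb (n - 4) (by omega) (by omega)
    rw [Nat.sub_add_cancel hn, ← ymod, Nat.mod_self] at h1
    exact mul_right_cancel₀ p0.ne' (by rw [one_mul]; exact h1.symm)

theorem cycleWithTwoBackArcs_complementaritySpectrum {n j : ℕ} (hn : 4 ≤ n) (hj : 3 ≤ j)
    (hjn : j < n) {r : ℝ} (hr : 1 < r) (hr1 : r ^ (n - 4) * (r ^ 2 - 1) ^ 2 = 1) :
    (cycleWithTwoBackArcs n j).complementaritySpectrum = {0, 1, r} := by
  ext a
  simp only [Set.mem_insert_iff, Set.mem_singleton_iff]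
  constructor
  · intro h
    by_cases h0 : a = 0
    · exact Or.inl h0
    by_cases h1 : a = 1
    · exact Or.inr (Or.inl h1)
    obtain ⟨h2, h3⟩ := root_of_isComplementarityEigenvalue hn hj hjn h h0 h1
    exact Or.inr (Or.inr (root_gt_one_unique h2 hr h3 hr1))
  · rintro (rfl | rfl | rfl)
    · exact isComplementarityEigenvalue_zero hn hj hjn
    · exact isComplementarityEigenvalue_one hn hj hjn
    · obtain ⟨x, hx, hAx⟩ := exists_pos_eigenvector hn hj hjn hr hr1
      have : Nonempty (Fin n) := ⟨⟨0, by omega⟩⟩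
      exact .of_mulVec_eq hx hAx

theorem mainTheorem5 (n : ℕ) (hn : 4 ≤ n) :
    (∀ j ∈ Finset.Icc 2 (n - 1),
      (cycleWithTwoBackArcs n j).order = n ∧ (cycleWithTwoBackArcs n j).size = n + 2) ∧
    (∀ i ∈ Finset.Icc 3 (n - 1), ∀ j ∈ Finset.Icc 3 (n - 1),
      (cycleWithTwoBackArcs n i).complementaritySpectrum =
        (cycleWithTwoBackArcs n j).complementaritySpectrum) ∧
    (∀ j ∈ Finset.Icc 3 (n - 1),
      (cycleWithTwoBackArcs n j).complementaritySpectrum =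
        {0, 1, (cycleWithTwoBackArcs n j).rho} ∧
      IsGreatest
        {x : ℝ | (Polynomial.X ^ n - 2 * Polynomial.X ^ (n - 2) + Polynomial.X ^ (n - 4) - 1 :
          Polynomial ℝ).IsRoot x}
        (cycleWithTwoBackArcs n j).rho) := by
  obtain ⟨r, hr, hr1⟩ := exists_root_gt_one (n - 4)
  have hmem : ∀ {a j : ℕ}, j ∈ Finset.Icc a (n - 1) → a ≤ j ∧ j < n := fun h => by
    rw [Finset.mem_Icc] at h
    omega
  refine ⟨fun j hj => ?_, fun i hi j hj => ?_, fun j hj => ?_⟩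
  · obtain ⟨h1, h2⟩ := hmem hj
    exact ⟨by simp [Digraph.order], cycleWithTwoBackArcs_size hn h1 h2⟩
  · obtain ⟨h1, h2⟩ := hmem hi
    obtain ⟨h3, h4⟩ := hmem hj
    rw [cycleWithTwoBackArcs_complementaritySpectrum hn h1 h2 hr hr1,
      cycleWithTwoBackArcs_complementaritySpectrum hn h3 h4 hr hr1]
  · obtain ⟨h1, h2⟩ := hmem hj
    rw [cycleWithTwoBackArcs_rho hn h1 h2 hr hr1]
    exact ⟨cycleWithTwoBackArcs_complementaritySpectrum hn h1 h2 hr hr1,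
      isGreatest_root hn hr hr1⟩
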